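/- Let $A$ be a nonempty countable set of observable actions, $\tau\notin A$, $A_\tau=A\cup\{\tau\}$, and let $V$ be a countably infinite set of variables. BCCS$(A)$ terms are built from the variables and the constant $\mathbf 0$ with the prefix operators $\alpha\_$ ($\alpha\in A_\tau$) and binary $+$. Transitions between terms are generated by the rules: $\alpha t\xrightarrow{\alpha}t$; if $t\xrightarrow{\alpha}t'$ then $t+u\xrightarrow{\alpha}t'$ and $u+t\xrightarrow{\alpha}t'$. Write $\Rightarrow$ for the reflexive-transitive closure of $\xrightarrow{\tau}$. A pair $(a_1\cdots a_k,B)$ with $k\ge 0$, $a_i\in A$, $B\subseteq A$ is a weak failure pair of a closed term $p$ if $p\Rightarrow\xrightarrow{a_1}\Rightarrow\cdots\Rightarrow\xrightarrow{a_k}\Rightarrow p'$ for some $p'$ with $\{\alpha\in A_\tau\mid \exists p''.\ p'\xrightarrow{\alpha}p''\}\subseteq A\setminus B$. For closed terms, $p\precsim_{\rm WF}q$ means that every weak failure pair of $p$ is a weak failure pair of $q$ and that if $p$ has an outgoing $\tau$-transition, then so does $q$. For a set $E$ of inequations between (open) terms, $E\vdash t\preccurlyeq u$ means that $t\preccurlyeq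 u$ is derivable from substitution instances of inequations in $E$ by reflexivity, transitivity and closure under prefixing and $+$; an equation $t\approx u$ in $E$ stands for $t\preccurlyeq u$ and $u\preccurlyeq t$. $E$ is sound modulo $\precsim_{\rm WF}$ if $E\vdash t\preccurlyeq u$ implies $\rho(t)\precsim_{\rm WF}\rho(u)$ for all closed substitutions $\rho$; ground-complete if $p\precsim_{\rm WF}q$ implies $E\vdash p\preccurlyeq q$ for all closed $p,q$; and $\omega$-complete if, for all terms $t,u$, whenever $E\vdash\rho(t)\preccurlyeq\rho(u)$ for all closed substitutions $\rho$, then $E\vdash t\preccurlyeq u$. Let $E_{\rm WF}$ consist of the axioms $$x+y\approx y+x,\quad (x+y)+z\approx x+(y+z),\quad x+x\approx x,\quad x+\mathbf 0\approx x,$$ $$\alpha(\tau x+\tau y)\approx\alpha x+\alpha y\ \ (\alpha\in A_\tau),\quad \tau(x+y)\preccurlyeq\tau x+y,\quad x\preccurlyeq\tau x+y,$$ where $x,y,z$ are distinct variables. Theorem. $E_{\rm WF}$ is sound and ground-complete for BCCS$(A)$ modulo $\precsim_{\rm WF}$. If $A$ is infinite, then $E_{\rm WF}$ is $\omega$-complete.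 If $A$ is finite, then $E_{\rm WF}$ together with the axiom $$\sum_{a\in A}a x_a\preccurlyeq\sum_{a\in A}a x_a+y\qquad(\text{the variables } x_a\ (a\in A) \text{ and } y \text{ being distinct})$$ is sound modulo $\precsim_{\rm WF}$ and $\omega$-complete. -/

import Mathlib

namespace BCCS

universe u v

/-- Actions: an observable action from the alphabet `A`, or the hidden action `τ`. -/
inductive Act (A : Type u) : Type u
  | tau : Act A
  | obs : A → Act A

/-- Open BCCS(`A`) terms with variables from `V`. -/
inductive Term (A : Type u) (V : Type v) : Type (max u v)
  | nil : Term A V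
  | var : V → Term A V
  | pre : Act A → Term A V → Term A V
  | add : Term A V → Term A V → Term A V

infixl:65 " ∔ " => Term.add

variable {A : Type u} {V : Type v}

namespace Term

/-- The set of variables that occur in a term. -/
def vars : Term A V → Set V
  | nil => ∅
  | var x => {x}
  | pre _ t => vars t
  | add t u => vars t ∪ vars u

/-- Closed terms. -/
def Closed (t : Term A V) : Prop := t.vars = ∅

/-- Application of a substitution to a term. -/
def subst (σ : V → Term A V) : Term A V → Term A V
  | nil => nil
  | var x => σ x
  | pre α t => pre α (subst σ t)
  | add t u => add (subst σ t) (subst σ u)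

/-- Prefixing with the hidden action. -/
abbrev tau (t : Term A V) : Term A V := pre Act.tau t

/-- Finite sums `t₁ + (t₂ + ⋯ + tₙ)`; the empty sum is `nil`. -/
def sum : List (Term A V) → Term A V
  | [] => nil
  | [t] => t
  | t :: u :: l => add t (sum (u :: l))

end Term

/-- Closed substitutions. -/
def ClosedSubst (ρ : V → Term A V) : Prop := ∀ x, (ρ x).Closed

/-- The transition relation on BCCS terms. There are no rules for variables. -/
inductive Step : Term A V → Act A → Term A V → Prop
  | pre (α : Act A) (t : Term A V) : Step (Term.pre α t) α t
  | left {t u t' : Term A V} {α : Act A} : Step t α t' → Step (t ∔ u) α t'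
  | right {t u u' : Term A V} {α : Act A} : Step u α u' → Step (t ∔ u) α u'

/-- The initial actions of a state. -/
def initials (t : Term A V) : Set (Act A) := {α | ∃ t', Step t α t'}

/-- `t ⇒ t'`: the reflexive-transitive closure of the `τ`-transitions. -/
def TauStar : Term A V → Term A V → Prop :=
  Relation.ReflTransGen (fun t t' => Step t Act.tau t')

/-- `WeakPath w t t'`: for `w = a₁ ⋯ aₖ`, there is a path from `t` to `t'` of the form
`⇒ -a₁→ ⇒ ⋯ ⇒ -aₖ→ ⇒`. -/
inductive WeakPath : List A → Term A V → Term A V → Prop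
  | nil {t t' : Term A V} : TauStar t t' → WeakPath [] t t'
  | cons {a : A} {w : List A} {t t₁ t₂ t' : Term A V} :
      TauStar t t₁ → Step t₁ (Act.obs a) t₂ → WeakPath w t₂ t' → WeakPath (a :: w) t t'

/-- `(w, B)` is a weak failure pair of `t`: after `w`, some state can be reached all of whose
initial actions lie in `A \ B` (in particular, that state has no outgoing `τ`-transition). -/
def IsWeakFailurePair (t : Term A V) (w : List A) (B : Set A) : Prop :=
  ∃ t', WeakPath w t t' ∧ initials t' ⊆ Act.obs '' Bᶜ

/-- The weak failures preorder. -/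
def WeakFailuresLE (t u : Term A V) : Prop :=
  (∀ (w : List A) (B : Set A), IsWeakFailurePair t w B → IsWeakFailurePair u w B) ∧
    ((∃ t', Step t Act.tau t') → ∃ u', Step u Act.tau u')

/-- An inequational axiomatization: a set of inequations `t ≼ u`, represented as pairs `(t, u)`. -/
abbrev Axiomatization (A : Type u) (V : Type v) := Set (Term A V × Term A V)

/-- `E ⊢ t ≼ u`: derivability in inequational logic. -/
inductive Derives (E : Axiomatization A V) : Term A V → Term A V → Prop
  | inst {t u : Term A V} (h : (t, u) ∈ E) (σ : V → Term A V) :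
      Derives E (t.subst σ) (u.subst σ)
  | refl (t : Term A V) : Derives E t t
  | trans {t u v : Term A V} : Derives E t u → Derives E u v → Derives E t v
  | pre (α : Act A) {t u : Term A V} : Derives E t u → Derives E (Term.pre α t) (Term.pre α u)
  | add {t₁ u₁ t₂ u₂ : Term A V} :
      Derives E t₁ u₁ → Derives E t₂ u₂ → Derives E (t₁ ∔ t₂) (u₁ ∔ u₂)

/-- Soundness modulo a relation on closed terms. -/
def Sound (E : Axiomatization A V) (R : Term A V → Term A V → Prop) : Prop :=
  ∀ t u, Derives E t u → ∀ ρ, ClosedSubst ρ → R (t.subst ρ) (u.subst ρ)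

/-- Ground-completeness modulo a relation on closed terms. -/
def GroundComplete (E : Axiomatization A V) (R : Term A V → Term A V → Prop) : Prop :=
  ∀ p q : Term A V, p.Closed → q.Closed → R p q → Derives E p q

/-- `ω`-completeness. -/
def OmegaComplete (E : Axiomatization A V) : Prop :=
  ∀ t u : Term A V, (∀ ρ, ClosedSubst ρ → Derives E (t.subst ρ) (u.subst ρ)) → Derives E t u

/-- An equation `t ≈ u` abbreviates the two inequations `t ≼ u` and `u ≼ t`. -/
def equation (t u : Term A V) : Axiomatization A V := {(t, u), (u, t)}

/-- An inequation `t ≼ u`. -/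
def inequation (t u : Term A V) : Axiomatization A V := {(t, u)}

section Axioms

open Term

/-! The axioms. The variables `x`, `y`, `z` in an axiom are arbitrary distinct variables. -/

/-- `x + y ≈ y + x` -/
def axA1 (A : Type u) (V : Type v) : Axiomatization A V :=
  {e | ∃ x y : V, x ≠ y ∧ e ∈ equation (var x ∔ var y) (var y ∔ var x)}

/-- `(x + y) + z ≈ x + (y + z)` -/
def axA2 (A : Type u) (V : Type v) : Axiomatization A V :=
  {e | ∃ x y z : V, x ≠ y ∧ x ≠ z ∧ y ≠ z ∧
    e ∈ equation ((var x ∔ var y) ∔ var z) (var x ∔ (var y ∔ var z))}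

/-- `x + x ≈ x` -/
def axA3 (A : Type u) (V : Type v) : Axiomatization A V :=
  {e | ∃ x : V, e ∈ equation (var x ∔ var x) (var x)}

/-- `x + 0 ≈ x` -/
def axA4 (A : Type u) (V : Type v) : Axiomatization A V :=
  {e | ∃ x : V, e ∈ equation (var x ∔ nil) (var x)}

/-- `α(τx + τy) ≈ αx + αy`, for every action `α` (observable or hidden) -/
def axWIF1 (A : Type u) (V : Type v) : Axiomatization A V :=
  {e | ∃ (α : Act A) (x y : V), x ≠ y ∧
    e ∈ equation (pre α (tau (var x) ∔ tau (var y))) (pre α (var x) ∔ pre α (var y))}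

/-- `τ(x + y) ≼ τx + y` -/
def axWIF2' (A : Type u) (V : Type v) : Axiomatization A V :=
  {e | ∃ x y : V, x ≠ y ∧ e ∈ inequation (tau (var x ∔ var y)) (tau (var x) ∔ var y)}

/-- `x ≼ τx + y` -/
def axW1' (A : Type u) (V : Type v) : Axiomatization A V :=
  {e | ∃ x y : V, x ≠ y ∧ e ∈ inequation (var x) (tau (var x) ∔ var y)}

/-- `∑ a ∈ A, a xₐ ≼ (∑ a ∈ A, a xₐ) + y`, where the variables `xₐ` and `y` are all distinct.
Here `l` lists the alphabet, which must be finite, in an arbitrary order without repetitions. -/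
def axF2 (A : Type u) (V : Type v) : Axiomatization A V :=
  {e | ∃ (l : List A) (x : A → V) (y : V), l.Nodup ∧ (∀ a, a ∈ l) ∧
    Function.Injective x ∧ (∀ a, x a ≠ y) ∧
    e ∈ inequation (sum (l.map fun a => pre (Act.obs a) (var (x a))))
      (sum (l.map fun a => pre (Act.obs a) (var (x a))) ∔ var y)}

/-- The axiomatization A1-4 + WIF1 + WIF2' + W1'. -/
def axWF (A : Type u) (V : Type v) : Axiomatization A V :=
  axA1 A V ∪ axA2 A V ∪ axA3 A V ∪ axA4 A V ∪ axWIF1 A V ∪ axWIF2' A V ∪ axW1' A V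

end Axioms

end BCCS

namespace BCCS

universe u v

variable {A : Type u} {V : Type v}

/-! ### Transitions -/

/-! Soundness: `WeakFailuresLE` is a precongruence, and every instance of every axiom satisfies it.

Both completeness results come from one relation on open terms, `OpenLE`, which compares stable
states together with their variable summands. The core is `OpenLE.derives`: `OpenLE K t u` yields `t
≼ u`, by induction on the size of `t`. For a summand `a s` of `t`, `s` lies below the sum of all `τ
s'` with `u ⇒ -a→ s'`, so induction and `α(τx + τy) ≼ αx + αy` give `a s ≼ ∑ a s'`. The `τ`-laws let
`u` absorb each `a s'`, and also each variable it can expose by `τ`-moves. If `t` is stable, its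
empty-trace failure supplies a stable `u'` with `u ⇒ u'`; adding `u'` to the transformed `t` leads
back to `u`, through `τ(x + y) ≼ τx + y` when `u' ≠ u`. If `t` is unstable, so is `u`, whence `t ≼ t
+ u`, and `u` absorbs the summands of `t`.

Closed terms have no variables, so there `OpenLE` follows from weak failures. For open terms,
`openLE_of_subst` recovers it from closed instances that send variables to `0` or to a long `aⁿ0`. A
state enabling every action hides its variables from this test. Such states do not exist for
infinite `A`, since terms have finitely many initial actions; for finite `A` the extra axiom deals
with them (`derives_full`). -/

@[simp] theorem step_nil {α : Act A} {r : Term A V} : ¬ Step Term.nil α r := by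
  intro h; cases h

@[simp] theorem step_var {x : V} {α : Act A} {r : Term A V} : ¬ Step (Term.var x) α r := by
  intro h; cases h

@[simp] theorem step_pre {α β : Act A} {t r : Term A V} :
    Step (Term.pre α t) β r ↔ β = α ∧ r = t := by
  constructor
  · intro h; cases h; exact ⟨rfl, rfl⟩
  · rintro ⟨rfl, rfl⟩; exact .pre _ _

@[simp] theorem step_add {α : Act A} {t u r : Term A V} :
    Step (t ∔ u) α r ↔ Step t α r ∨ Step u α r := by
  constructor
  · intro h
    cases h with
    | left h => exact .inl h
    | right h => exact .inr h
  · rintro (h | h)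
    exacts [.left h, .right h]

/-- A term without outgoing `τ`-transitions. -/
def Stable (t : Term A V) : Prop := ∀ t', ¬ Step t Act.tau t'

/-- The variables that occur as summands of a term. -/
def topVars : Term A V → Set V
  | .nil => ∅
  | .var x => {x}
  | .pre _ _ => ∅
  | .add t u => topVars t ∪ topVars u

@[simp] theorem topVars_nil : topVars (Term.nil : Term A V) = ∅ := rfl
@[simp] theorem topVars_var (x : V) : topVars (Term.var x : Term A V) = {x} := rfl
@[simp] theorem topVars_pre (α : Act A) (t : Term A V) : topVars (Term.pre α t) = ∅ := rfl
@[simp] theorem topVars_add (t u : Term A V) : topVars (t ∔ u) = topVars t ∪ topVars u := rfl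

/-- The number of operators in a term. -/
def size : Term A V → ℕ
  | .nil => 0
  | .var _ => 0
  | .pre _ t => size t + 1
  | .add t u => size t + size u + 1

theorem Step.size_lt {t r : Term A V} {α : Act A} (h : Step t α r) : size r < size t := by
  induction h with
  | pre => simp [size]
  | left _ ih => simp only [size]; omega
  | right _ ih => simp only [size]; omega

/-- `Run w t t'`: a path from `t` to `t'` whose sequence of observable actions is `w`. -/
inductive Run : List A → Term A V → Term A V → Prop
  | refl (t : Term A V) : Run [] t t
  | tau {w : List A} {t r t' : Term A V} : Step t Act.tau r → Run w r t' → Run w t t'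
  | obs {w : List A} {a : A} {t r t' : Term A V} :
      Step t (Act.obs a) r → Run w r t' → Run (a :: w) t t'

theorem Run.of_tauStar {w : List A} {t r t' : Term A V} (h : TauStar t r) (h' : Run w r t') :
    Run w t t' := by
  induction h using Relation.ReflTransGen.head_induction_on with
  | refl => exact h'
  | head h _ ih => exact .tau h ih

/-- `Run` consumes one transition per constructor, which suits induction and case analysis on the
first move. -/
theorem weakPath_iff {w : List A} {t t' : Term A V} : WeakPath w t t' ↔ Run w t t' := by
  constructor
  · intro h
    induction h with
    | nil h => exact .of_tauStar h (.refl _)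
    | cons h h' _ ih => exact .of_tauStar h (.obs h' ih)
  · intro h
    induction h with
    | refl => exact .nil .refl
    | tau h _ ih =>
      cases ih with
      | nil h' => exact .nil (.head h h')
      | cons h₁ h₂ h₃ => exact .cons (.head h h₁) h₂ h₃
    | obs h _ ih => exact .cons .refl h ih

theorem Run.trans {w w' : List A} {t r t' : Term A V} (h : Run w t r) (h' : Run w' r t') :
    Run (w ++ w') t t' := by
  induction h with
  | refl => exact h'
  | tau h _ ih => exact .tau h (ih h')
  | obs h _ ih => exact .obs h (ih h')

theorem Run.length_le {w : List A} {t t' : Term A V} (h : Run w t t') :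
    w.length ≤ size t := by
  induction h with
  | refl => simp
  | tau h _ ih => have := h.size_lt; omega
  | obs h _ ih => have := h.size_lt; simp only [List.length_cons]; omega

/-- Transitions decrease the size, so a sequence of `τ`-moves must end. -/
theorem exists_run_stable (t : Term A V) : ∃ t', Run [] t t' ∧ Stable t' := by
  induction h : size t using Nat.strong_induction_on generalizing t with
  | _ n ih =>
    by_cases hs : Stable t
    · exact ⟨t, .refl t, hs⟩
    · simp only [Stable, not_forall, not_not] at hs
      obtain ⟨r, hr⟩ := hs
      obtain ⟨t', h₁, h₂⟩ := ih (size r) (h ▸ hr.size_lt) r rfl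
      exact ⟨t', .tau hr h₁, h₂⟩

theorem fp_iff_run {t : Term A V} {w : List A} {B : Set A} :
    IsWeakFailurePair t w B ↔ ∃ t', Run w t t' ∧ initials t' ⊆ Act.obs '' Bᶜ := by
  simp only [IsWeakFailurePair, weakPath_iff]

theorem fp_iff {t : Term A V} {w : List A} {B : Set A} :
    IsWeakFailurePair t w B ↔ (w = [] ∧ initials t ⊆ Act.obs '' Bᶜ) ∨
      (∃ r, Step t Act.tau r ∧ IsWeakFailurePair r w B) ∨
      ∃ a w' r, w = a :: w' ∧ Step t (Act.obs a) r ∧ IsWeakFailurePair r w' B := by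
  simp only [fp_iff_run]
  constructor
  · rintro ⟨t', h, h'⟩
    cases h with
    | refl => exact .inl ⟨rfl, h'⟩
    | tau h₁ h₂ => exact .inr (.inl ⟨_, h₁, _, h₂, h'⟩)
    | obs h₁ h₂ => exact .inr (.inr ⟨_, _, _, rfl, h₁, _, h₂, h'⟩)
  · rintro (⟨rfl, h⟩ | ⟨r, h, t', h₁, h₂⟩ | ⟨a, w', r, rfl, h, t', h₁, h₂⟩)
    exacts [⟨t, .refl t, h⟩, ⟨t', .tau h h₁, h₂⟩, ⟨t', .obs h h₁, h₂⟩]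

theorem fp_of_tau {t r : Term A V} {w : List A} {B : Set A} (h : Step t Act.tau r)
    (h' : IsWeakFailurePair r w B) : IsWeakFailurePair t w B :=
  fp_iff.2 (.inr (.inl ⟨r, h, h'⟩))

theorem fp_of_obs {t r : Term A V} {a : A} {w : List A} {B : Set A} (h : Step t (Act.obs a) r)
    (h' : IsWeakFailurePair r w B) : IsWeakFailurePair t (a :: w) B :=
  fp_iff.2 (.inr (.inr ⟨a, w, r, rfl, h, h'⟩))

theorem Stable.of_initials {t : Term A V} {B : Set A} (h : initials t ⊆ Act.obs '' B) :
    Stable t := by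
  intro r hr
  obtain ⟨a, -, ha⟩ := h ⟨r, hr⟩
  cases ha

theorem initials_add (t u : Term A V) : initials (t ∔ u) = initials t ∪ initials u := by
  ext α; simp [initials, exists_or]

/-! ### Soundness -/

theorem WeakFailuresLE.refl (t : Term A V) : WeakFailuresLE t t := ⟨fun _ _ h => h, id⟩

theorem WeakFailuresLE.trans {t u v : Term A V} (h : WeakFailuresLE t u)
    (h' : WeakFailuresLE u v) : WeakFailuresLE t v :=
  ⟨fun w B hw => h'.1 w B (h.1 w B hw), fun ht => h'.2 (h.2 ht)⟩

theorem WeakFailuresLE.pre (α : Act A) {t u : Term A V} (h : WeakFailuresLE t u) :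
    WeakFailuresLE (Term.pre α t) (Term.pre α u) := by
  refine ⟨fun w B h₀ => ?_, ?_⟩
  · obtain ⟨rfl, hw⟩ | ⟨r, hr, hw⟩ | ⟨a, w, r, rfl, hr, hw⟩ := fp_iff.1 h₀
    · refine fp_iff.2 (.inl ⟨rfl, ?_⟩)
      simpa [initials] using hw
    · obtain ⟨rfl, rfl⟩ := step_pre.1 hr
      exact fp_of_tau (.pre _ _) (h.1 _ _ hw)
    · obtain ⟨rfl, rfl⟩ := step_pre.1 hr
      exact fp_of_obs (.pre _ _) (h.1 _ _ hw)
  · rintro ⟨r, hr⟩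
    obtain ⟨rfl, rfl⟩ := step_pre.1 hr
    exact ⟨_, .pre _ _⟩

/-- The side condition excludes the only pairs that a context `+ u` can destroy: those with empty
trace refused by a stable `t` itself, where `u` may add initial actions. This is why the preorder
has its clause on initial `τ`-transitions. -/
theorem fp_add_left {t u : Term A V} {w : List A} {B : Set A} (h : IsWeakFailurePair t w B)
    (ht : w ≠ [] ∨ ∃ r, Step t Act.tau r) : IsWeakFailurePair (t ∔ u) w B := by
  obtain ⟨rfl, hw⟩ | ⟨r, hr, hw⟩ | ⟨a, w, r, rfl, hr, hw⟩ := fp_iff.1 h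
  · obtain ht | ⟨r, hr⟩ := ht
    · exact absurd rfl ht
    · exact absurd hr (Stable.of_initials hw r)
  · exact fp_of_tau (.left hr) hw
  · exact fp_of_obs (.left hr) hw

theorem WeakFailuresLE.of_steps {t u : Term A V} (h : ∀ α r, Step t α r ↔ Step u α r) :
    WeakFailuresLE t u := by
  have hi : initials t = initials u := by ext α; simp [initials, h]
  refine ⟨fun w B hw => ?_, fun ⟨r, hr⟩ => ⟨r, (h _ _).1 hr⟩⟩
  rw [fp_iff] at hw ⊢
  simpa only [h, hi] using hw

theorem fp_add_right {t u : Term A V} {w : List A} {B : Set A} (h : IsWeakFailurePair u w B)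
    (hu : w ≠ [] ∨ ∃ r, Step u Act.tau r) : IsWeakFailurePair (t ∔ u) w B :=
  (WeakFailuresLE.of_steps (t := u ∔ t) fun _ _ => by simp [or_comm]).1 _ _ (fp_add_left h hu)

theorem WeakFailuresLE.add {t₁ u₁ t₂ u₂ : Term A V} (h₁ : WeakFailuresLE t₁ u₁)
    (h₂ : WeakFailuresLE t₂ u₂) : WeakFailuresLE (t₁ ∔ t₂) (u₁ ∔ u₂) := by
  refine ⟨fun w B h₀ => ?_, ?_⟩
  · obtain ⟨rfl, hw⟩ | ⟨r, hr, hw⟩ | ⟨a, w, r, rfl, hr, hw⟩ := fp_iff.1 h₀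
    · rw [initials_add, Set.union_subset_iff] at hw
      -- If neither `u₁` nor `u₂` has to move to exhibit its refusal, their sum refuses `B`;
      -- otherwise a `τ`-move of one of them discards the other.
      have f₁ := h₁.1 [] B (fp_iff.2 (.inl ⟨rfl, hw.1⟩))
      have f₂ := h₂.1 [] B (fp_iff.2 (.inl ⟨rfl, hw.2⟩))
      obtain ⟨-, g₁⟩ | ⟨r, hr, -⟩ | ⟨_, _, _, h, _⟩ := fp_iff.1 f₁
      · obtain ⟨-, g₂⟩ | ⟨r, hr, -⟩ | ⟨_, _, _, h, _⟩ := fp_iff.1 f₂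
        · exact fp_iff.2 (.inl ⟨rfl, initials_add u₁ u₂ ▸ Set.union_subset g₁ g₂⟩)
        · exact fp_add_right f₂ (.inr ⟨r, hr⟩)
        · cases h
      · exact fp_add_left f₁ (.inr ⟨r, hr⟩)
      · cases h
    · obtain hr | hr := step_add.1 hr
      · exact fp_add_left (h₁.1 _ _ (fp_of_tau hr hw)) (.inr (h₁.2 ⟨r, hr⟩))
      · exact fp_add_right (h₂.1 _ _ (fp_of_tau hr hw)) (.inr (h₂.2 ⟨r, hr⟩))
    · obtain hr | hr := step_add.1 hr
      · exact fp_add_left (h₁.1 _ _ (fp_of_obs hr hw)) (.inl (by simp))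
      · exact fp_add_right (h₂.1 _ _ (fp_of_obs hr hw)) (.inl (by simp))
  · rintro ⟨r, hr⟩
    obtain hr | hr := step_add.1 hr
    · obtain ⟨s, hs⟩ := h₁.2 ⟨r, hr⟩; exact ⟨s, .left hs⟩
    · obtain ⟨s, hs⟩ := h₂.2 ⟨r, hr⟩; exact ⟨s, .right hs⟩

theorem fp_tau_add_tau {t u : Term A V} {w : List A} {B : Set A} :
    IsWeakFailurePair (t.tau ∔ u.tau) w B ↔
      IsWeakFailurePair t w B ∨ IsWeakFailurePair u w B := by
  rw [fp_iff]
  constructor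
  · rintro (⟨rfl, h⟩ | ⟨r, hr, hw⟩ | ⟨a, w, r, rfl, hr, hw⟩)
    · exact absurd (.left (.pre _ _)) (Stable.of_initials h t)
    · simp only [step_add, step_pre, true_and] at hr
      obtain rfl | rfl := hr
      exacts [.inl hw, .inr hw]
    · simp at hr
  · rintro (h | h)
    · exact .inr (.inl ⟨t, by simp, h⟩)
    · exact .inr (.inl ⟨u, by simp, h⟩)

theorem weakFailuresLE_merge (α : Act A) (t u : Term A V) :
    WeakFailuresLE (Term.pre α (t.tau ∔ u.tau)) (Term.pre α t ∔ Term.pre α u) := by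
  refine ⟨fun w B h₀ => ?_, ?_⟩
  · obtain ⟨rfl, hw⟩ | ⟨r, hr, hw⟩ | ⟨a, w, r, rfl, hr, hw⟩ := fp_iff.1 h₀
    · exact fp_iff.2 (.inl ⟨rfl, by simpa [initials, exists_or] using hw⟩)
    all_goals
      obtain ⟨rfl, rfl⟩ := step_pre.1 hr
      obtain hw | hw := fp_tau_add_tau.1 hw
    · exact fp_of_tau (.left (.pre _ _)) hw
    · exact fp_of_tau (.right (.pre _ _)) hw
    · exact fp_of_obs (.left (.pre _ _)) hw
    · exact fp_of_obs (.right (.pre _ _)) hw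
  · rintro ⟨r, hr⟩
    obtain ⟨rfl, -⟩ := step_pre.1 hr
    exact ⟨t, by simp⟩

theorem weakFailuresLE_split (α : Act A) (t u : Term A V) :
    WeakFailuresLE (Term.pre α t ∔ Term.pre α u) (Term.pre α (t.tau ∔ u.tau)) := by
  refine ⟨fun w B h₀ => ?_, ?_⟩
  · obtain ⟨rfl, hw⟩ | ⟨r, hr, hw⟩ | ⟨a, w, r, rfl, hr, hw⟩ := fp_iff.1 h₀
    · exact fp_iff.2 (.inl ⟨rfl, by simpa [initials, exists_or] using hw⟩)
    all_goals simp only [step_add, step_pre] at hr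
    all_goals obtain ⟨rfl, rfl⟩ | ⟨rfl, rfl⟩ := hr
    · exact fp_of_tau (.pre _ _) (fp_tau_add_tau.2 (.inl hw))
    · exact fp_of_tau (.pre _ _) (fp_tau_add_tau.2 (.inr hw))
    · exact fp_of_obs (.pre _ _) (fp_tau_add_tau.2 (.inl hw))
    · exact fp_of_obs (.pre _ _) (fp_tau_add_tau.2 (.inr hw))
  · rintro ⟨r, hr⟩
    simp only [step_add, step_pre] at hr
    obtain ⟨rfl, -⟩ | ⟨rfl, -⟩ := hr <;> exact ⟨_, .pre _ _⟩

theorem weakFailuresLE_tau_add (t u : Term A V) :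
    WeakFailuresLE t (t.tau ∔ u) :=
  ⟨fun _ _ hw => fp_of_tau (.left (.pre _ _)) hw, fun _ => ⟨t, .left (.pre _ _)⟩⟩

theorem weakFailuresLE_tau_dist (t u : Term A V) :
    WeakFailuresLE (t ∔ u).tau (t.tau ∔ u) := by
  refine ⟨fun w B h₀ => ?_, fun _ => ⟨t, .left (.pre _ _)⟩⟩
  have h₁ : IsWeakFailurePair (t ∔ u) w B := by
    obtain ⟨rfl, hw⟩ | ⟨r, hr, hw⟩ | ⟨a, w, r, rfl, hr, hw⟩ := fp_iff.1 h₀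
    · exact absurd (.pre _ _) (Stable.of_initials hw (t ∔ u))
    · obtain ⟨-, rfl⟩ := step_pre.1 hr; exact hw
    · simp at hr
  have ht : IsWeakFailurePair t w B → IsWeakFailurePair (t.tau ∔ u) w B :=
    fp_of_tau (.left (.pre _ _))
  obtain ⟨rfl, hw⟩ | ⟨r, hr, hw⟩ | ⟨a, w, r, rfl, hr, hw⟩ := fp_iff.1 h₁
  · rw [initials_add, Set.union_subset_iff] at hw
    exact ht (fp_iff.2 (.inl ⟨rfl, hw.1⟩))
  · obtain hr | hr := step_add.1 hr
    · exact ht (fp_of_tau hr hw)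
    · exact fp_of_tau (.right hr) hw
  · obtain hr | hr := step_add.1 hr
    · exact ht (fp_of_obs hr hw)
    · exact fp_of_obs (.right hr) hw

/-- As `t` is stable and enables every action, an empty-trace pair of `t` has `B = ∅`, and any
stable state reachable from `t ∔ u` witnesses it. Pairs with nonempty trace survive the addition of
`u`. -/
theorem weakFailuresLE_full {t : Term A V} (ht : ∀ a, ∃ r, Step t (Act.obs a) r)
    (u : Term A V) (h : Stable t) : WeakFailuresLE t (t ∔ u) := by
  refine ⟨fun w B h₀ => ?_, fun ⟨r, hr⟩ => ⟨r, .left hr⟩⟩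
  obtain ⟨rfl, hi⟩ | ⟨r, hr, -⟩ | ⟨a, w, r, rfl, -, -⟩ := fp_iff.1 h₀
  · obtain ⟨r, hr, hs⟩ := exists_run_stable (t ∔ u)
    refine fp_iff_run.2 ⟨r, hr, ?_⟩
    rintro (_ | a) ⟨s, hr⟩
    · exact absurd hr (hs s)
    · exact hi (ht a)
  · exact absurd hr (h r)
  · exact fp_add_left h₀ (.inl (by simp))

/-! ### Soundness of derivations from the soundness of axiom instances -/

theorem subst_subst (σ ρ : V → Term A V) (t : Term A V) :
    (t.subst σ).subst ρ = t.subst fun x => (σ x).subst ρ := by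
  induction t with
  | nil => rfl
  | var => rfl
  | pre α t ih => simp [Term.subst, ih]
  | add t u iht ihu => simp [Term.subst, iht, ihu]

theorem sound_of_axioms {E : Axiomatization A V}
    (h : ∀ t u, (t, u) ∈ E → ∀ σ, WeakFailuresLE (t.subst σ) (u.subst σ)) :
    Sound E WeakFailuresLE := by
  intro t u htu ρ _
  induction htu with
  | inst hE σ => rw [subst_subst, subst_subst]; exact h _ _ hE _
  | refl t => exact .refl _
  | trans _ _ ih₁ ih₂ => exact ih₁.trans ih₂
  | pre α _ ih => exact ih.pre α
  | add _ _ ih₁ ih₂ => exact ih₁.add ih₂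

theorem axWF_valid (t u : Term A V) (h : (t, u) ∈ axWF A V) (σ : V → Term A V) :
    WeakFailuresLE (t.subst σ) (u.subst σ) := by
  obtain (((((⟨x, y, -, h⟩ | ⟨x, y, z, -, -, -, h⟩) | ⟨x, h⟩) | ⟨x, h⟩) | ⟨α, x, y, -, h⟩) |
    ⟨x, y, -, h⟩) | ⟨x, y, -, h⟩ := h
  all_goals simp only [equation, inequation, Set.mem_insert_iff, Set.mem_singleton_iff,
    Prod.mk.injEq] at h
  · obtain ⟨rfl, rfl⟩ | ⟨rfl, rfl⟩ := h <;> refine .of_steps fun _ _ => ?_ <;>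
      simp [Term.subst, or_comm]
  · obtain ⟨rfl, rfl⟩ | ⟨rfl, rfl⟩ := h <;> refine .of_steps fun _ _ => ?_ <;>
      simp [Term.subst, or_assoc]
  · obtain ⟨rfl, rfl⟩ | ⟨rfl, rfl⟩ := h <;> refine .of_steps fun _ _ => ?_ <;>
      simp [Term.subst]
  · obtain ⟨rfl, rfl⟩ | ⟨rfl, rfl⟩ := h <;> refine .of_steps fun _ _ => ?_ <;>
      simp [Term.subst]
  · obtain ⟨rfl, rfl⟩ | ⟨rfl, rfl⟩ := h
    exacts [weakFailuresLE_merge _ _ _, weakFailuresLE_split _ _ _]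
  · obtain ⟨rfl, rfl⟩ := h
    exact weakFailuresLE_tau_dist _ _
  · obtain ⟨rfl, rfl⟩ := h
    exact weakFailuresLE_tau_add _ _

theorem subst_sum (σ : V → Term A V) (l : List (Term A V)) :
    (Term.sum l).subst σ = Term.sum (l.map (Term.subst σ)) := by
  induction l with
  | nil => rfl
  | cons t l ih =>
    cases l with
    | nil => rfl
    | cons u l => simp only [List.map_cons, Term.sum, Term.subst] at ih ⊢; rw [ih]

theorem step_sum {l : List (Term A V)} {α : Act A} {r : Term A V} :
    Step (Term.sum l) α r ↔ ∃ t ∈ l, Step t α r := by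
  induction l with
  | nil => simp [Term.sum]
  | cons t l ih =>
    cases l with
    | nil => simp [Term.sum]
    | cons u l => rw [Term.sum, step_add, ih]; simp

theorem topVars_sum {l : List (Term A V)} {x : V} :
    x ∈ topVars (Term.sum l) ↔ ∃ t ∈ l, x ∈ topVars t := by
  induction l with
  | nil => simp [Term.sum]
  | cons t l ih =>
    cases l with
    | nil => simp [Term.sum]
    | cons u l => rw [Term.sum, topVars_add, Set.mem_union, ih]; simp

theorem axF2_valid (t u : Term A V) (h : (t, u) ∈ axF2 A V) (σ : V → Term A V) :
    WeakFailuresLE (t.subst σ) (u.subst σ) := by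
  obtain ⟨l, x, y, -, hl, -, -, h⟩ := h
  simp only [inequation, Set.mem_singleton_iff, Prod.mk.injEq] at h
  obtain ⟨rfl, rfl⟩ := h
  refine weakFailuresLE_full (fun a => ⟨σ (x a), ?_⟩) _ fun r hr => ?_
  · rw [subst_sum, step_sum]
    exact ⟨.pre (.obs a) (σ (x a)), by simpa using ⟨a, hl a, rfl⟩, .pre _ _⟩
  · rw [subst_sum, step_sum] at hr
    simp [Term.subst] at hr

theorem axWF_sound : Sound (axWF A V) WeakFailuresLE := sound_of_axioms axWF_valid

theorem axWF_axF2_sound : Sound (axWF A V ∪ axF2 A V) WeakFailuresLE :=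
  sound_of_axioms fun t u h => h.elim (axWF_valid t u) (axF2_valid t u)

/-! ### Derived laws -/

instance (E : Axiomatization A V) : Trans (Derives E) (Derives E) (Derives E) :=
  ⟨Derives.trans⟩

theorem exists_three_distinct (V : Type v) [Infinite V] :
    ∃ x y z : V, x ≠ y ∧ x ≠ z ∧ y ≠ z := by
  let f := Infinite.natEmbedding V
  exact ⟨f 0, f 1, f 2, by simp, by simp, by simp⟩

section Laws

open Classical in
-- The axioms are stated for distinct variables; infinitely many variables leave room to send three
-- of them to arbitrary terms.
theorem Derives.inst_three [Infinite V] {E : Axiomatization A V}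
    {t u : V → V → V → Term A V} (p q r : Term A V)
    (h : ∀ x y z, x ≠ y → x ≠ z → y ≠ z → (t x y z, u x y z) ∈ E) :
    ∃ (σ : V → Term A V) (x y z : V), σ x = p ∧ σ y = q ∧ σ z = r ∧
      Derives E ((t x y z).subst σ) ((u x y z).subst σ) := by
  obtain ⟨x, y, z, hxy, hxz, hyz⟩ := exists_three_distinct V
  refine ⟨fun v => if v = x then p else if v = y then q else r, x, y, z, ?_, ?_, ?_,
    .inst (h x y z hxy hxz hyz) _⟩
  · simp
  · simp [hxy.symm]
  · simp [hxz.symm, hyz.symm]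

variable [Infinite V] {E : Axiomatization A V} (hE : axWF A V ⊆ E)

include hE

theorem derives_comm (p q : Term A V) : Derives E (p ∔ q) (q ∔ p) := by
  obtain ⟨σ, x, y, z, rfl, rfl, -, h⟩ := Derives.inst_three (E := E) p q p
    (t := fun x y _ => .var x ∔ .var y) (u := fun x y _ => .var y ∔ .var x)
    fun x y z hxy _ _ => hE <| by
      simp only [axWF, Set.mem_union]; iterate 6 left
      exact ⟨x, y, hxy, .inl rfl⟩
  exact h

theorem derives_assoc (p q r : Term A V) : Derives E (p ∔ q ∔ r) (p ∔ (q ∔ r)) := by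
  obtain ⟨σ, x, y, z, rfl, rfl, rfl, h⟩ := Derives.inst_three (E := E) p q r
    (t := fun x y z => .var x ∔ .var y ∔ .var z) (u := fun x y z => .var x ∔ (.var y ∔ .var z))
    fun x y z hxy hxz hyz => hE <| by
      simp only [axWF, Set.mem_union]; iterate 5 left
      exact .inr ⟨x, y, z, hxy, hxz, hyz, .inl rfl⟩
  exact h

theorem derives_assoc' (p q r : Term A V) : Derives E (p ∔ (q ∔ r)) (p ∔ q ∔ r) := by
  obtain ⟨σ, x, y, z, rfl, rfl, rfl, h⟩ := Derives.inst_three (E := E) p q r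
    (u := fun x y z => .var x ∔ .var y ∔ .var z) (t := fun x y z => .var x ∔ (.var y ∔ .var z))
    fun x y z hxy hxz hyz => hE <| by
      simp only [axWF, Set.mem_union]; iterate 5 left
      exact .inr ⟨x, y, z, hxy, hxz, hyz, .inr rfl⟩
  exact h

theorem derives_idem (p : Term A V) : Derives E (p ∔ p) p := by
  obtain ⟨σ, x, y, z, rfl, -, -, h⟩ := Derives.inst_three (E := E) p p p
    (t := fun x _ _ => .var x ∔ .var x) (u := fun x _ _ => .var x)
    fun x y z _ _ _ => hE <| by
      simp only [axWF, Set.mem_union]; iterate 4 left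
      exact .inr ⟨x, .inl rfl⟩
  exact h

theorem derives_dup (p : Term A V) : Derives E p (p ∔ p) := by
  obtain ⟨σ, x, y, z, rfl, -, -, h⟩ := Derives.inst_three (E := E) p p p
    (u := fun x _ _ => .var x ∔ .var x) (t := fun x _ _ => .var x)
    fun x y z _ _ _ => hE <| by
      simp only [axWF, Set.mem_union]; iterate 4 left
      exact .inr ⟨x, .inr rfl⟩
  exact h

theorem derives_add_nil (p : Term A V) : Derives E (p ∔ .nil) p := by
  obtain ⟨σ, x, y, z, rfl, -, -, h⟩ := Derives.inst_three (E := E) p p p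
    (t := fun x _ _ => .var x ∔ .nil) (u := fun x _ _ => .var x)
    fun x y z _ _ _ => hE <| by
      simp only [axWF, Set.mem_union]; iterate 3 left
      exact .inr ⟨x, .inl rfl⟩
  exact h

theorem derives_of_add_nil (p : Term A V) : Derives E p (p ∔ .nil) := by
  obtain ⟨σ, x, y, z, rfl, -, -, h⟩ := Derives.inst_three (E := E) p p p
    (u := fun x _ _ => .var x ∔ .nil) (t := fun x _ _ => .var x)
    fun x y z _ _ _ => hE <| by
      simp only [axWF, Set.mem_union]; iterate 3 left
      exact .inr ⟨x, .inr rfl⟩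
  exact h

theorem derives_merge (α : Act A) (p q : Term A V) :
    Derives E (.pre α (p.tau ∔ q.tau)) (.pre α p ∔ .pre α q) := by
  obtain ⟨σ, x, y, z, rfl, rfl, -, h⟩ := Derives.inst_three (E := E) p q p
    (t := fun x y _ => .pre α ((Term.var x).tau ∔ (Term.var y).tau))
    (u := fun x y _ => .pre α (.var x) ∔ .pre α (.var y))
    fun x y z hxy _ _ => hE <| by
      simp only [axWF, Set.mem_union]; iterate 2 left
      exact .inr ⟨α, x, y, hxy, .inl rfl⟩
  exact h

theorem derives_tau_dist (p q : Term A V) : Derives E (p ∔ q).tau (p.tau ∔ q) := by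
  obtain ⟨σ, x, y, z, rfl, rfl, -, h⟩ := Derives.inst_three (E := E) p q p
    (t := fun x y _ => (Term.var x ∔ Term.var y).tau)
    (u := fun x y _ => (Term.var x).tau ∔ .var y)
    fun x y z hxy _ _ => hE <| by
      simp only [axWF, Set.mem_union]; left
      exact .inr ⟨x, y, hxy, rfl⟩
  exact h

theorem derives_tau_add (p q : Term A V) : Derives E p (p.tau ∔ q) := by
  obtain ⟨σ, x, y, z, rfl, rfl, -, h⟩ := Derives.inst_three (E := E) p q p
    (t := fun x y _ => Term.var x)
    (u := fun x y _ => (Term.var x).tau ∔ .var y)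
    fun x y z hxy _ _ => hE <| by
      simp only [axWF, Set.mem_union]
      exact .inr ⟨x, y, hxy, rfl⟩
  exact h

theorem derives_nil_add (p : Term A V) : Derives E (.nil ∔ p) p :=
  (derives_comm hE _ _).trans (derives_add_nil hE p)

theorem derives_of_nil_add (p : Term A V) : Derives E p (.nil ∔ p) :=
  (derives_of_add_nil hE p).trans (derives_comm hE _ _)

theorem derives_left_comm (p q r : Term A V) : Derives E (p ∔ (q ∔ r)) (q ∔ (p ∔ r)) :=
  (derives_assoc' hE p q r).trans
    (((derives_comm hE p q).add (.refl r)).trans (derives_assoc hE q p r))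

/-- If every summand of `t` is absorbed by `u`, then so is `t`. -/
theorem derives_absorb {t u : Term A V}
    (hs : ∀ α r, Step t α r → Derives E (.pre α r ∔ u) u)
    (hv : ∀ x ∈ topVars t, Derives E (.var x ∔ u) u) : Derives E (t ∔ u) u := by
  induction t with
  | nil => exact derives_nil_add hE u
  | var x => exact hv x rfl
  | pre α t => exact hs α t (.pre α t)
  | add t₁ t₂ ih₁ ih₂ =>
    calc Derives E (t₁ ∔ t₂ ∔ u) (t₁ ∔ (t₂ ∔ u)) := derives_assoc hE _ _ _
      Derives E _ (t₁ ∔ u) :=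
        (Derives.refl _).add (ih₂ (fun α r h => hs α r (.right h)) fun x h => hv x (.inr h))
      Derives E _ u := ih₁ (fun α r h => hs α r (.left h)) fun x h => hv x (.inl h)

theorem derives_coabsorb {t u : Term A V}
    (hs : ∀ α r, Step t α r → Derives E u (.pre α r ∔ u))
    (hv : ∀ x ∈ topVars t, Derives E u (.var x ∔ u)) : Derives E u (t ∔ u) := by
  induction t with
  | nil => exact derives_of_nil_add hE u
  | var x => exact hv x rfl
  | pre α t => exact hs α t (.pre α t)
  | add t₁ t₂ ih₁ ih₂ =>
    calc Derives E u (t₁ ∔ u) := ih₁ (fun α r h => hs α r (.left h)) fun x h => hv x (.inl h)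
      Derives E _ (t₁ ∔ (t₂ ∔ u)) :=
        (Derives.refl _).add (ih₂ (fun α r h => hs α r (.right h)) fun x h => hv x (.inr h))
      Derives E _ (t₁ ∔ t₂ ∔ u) := derives_assoc' hE _ _ _

theorem derives_add_of_step {u r : Term A V} {α : Act A} (h : Step u α r) :
    Derives E (.pre α r ∔ u) u ∧ Derives E u (.pre α r ∔ u) := by
  induction h with
  | pre => exact ⟨derives_idem hE _, derives_dup hE _⟩
  | left _ ih =>
    exact ⟨(derives_assoc' hE _ _ _).trans (ih.1.add (.refl _)),
      (ih.2.add (.refl _)).trans (derives_assoc hE _ _ _)⟩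
  | right _ ih =>
    exact ⟨(derives_left_comm hE _ _ _).trans ((Derives.refl _).add ih.1),
      ((Derives.refl _).add ih.2).trans (derives_left_comm hE _ _ _)⟩

theorem derives_add_of_topVar {u : Term A V} {x : V} (h : x ∈ topVars u) :
    Derives E (.var x ∔ u) u ∧ Derives E u (.var x ∔ u) := by
  induction u with
  | nil => cases h
  | var y => cases h; exact ⟨derives_idem hE _, derives_dup hE _⟩
  | pre => cases h
  | add t u iht ihu =>
    obtain h | h := h
    · have ih := iht h
      exact ⟨(derives_assoc' hE _ _ _).trans (ih.1.add (.refl _)),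
        (ih.2.add (.refl _)).trans (derives_assoc hE _ _ _)⟩
    · have ih := ihu h
      exact ⟨(derives_left_comm hE _ _ _).trans ((Derives.refl _).add ih.1),
        ((Derives.refl _).add ih.2).trans (derives_left_comm hE _ _ _)⟩

theorem derives_add_of_subset {t u : Term A V} (hs : ∀ α r, Step t α r → Step u α r)
    (hv : topVars t ⊆ topVars u) : Derives E (t ∔ u) u :=
  derives_absorb hE (fun _ _ h => (derives_add_of_step hE (hs _ _ h)).1)
    fun _ h => (derives_add_of_topVar hE (hv h)).1

theorem derives_of_add_of_subset {t u : Term A V} (hs : ∀ α r, Step t α r → Step u α r)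
    (hv : topVars t ⊆ topVars u) : Derives E u (t ∔ u) :=
  derives_coabsorb hE (fun _ _ h => (derives_add_of_step hE (hs _ _ h)).2)
    fun _ h => (derives_add_of_topVar hE (hv h)).2

/-- Terms with the same summands are provably equal. -/
theorem derives_of_summands {t u : Term A V} (hs : ∀ α r, Step t α r ↔ Step u α r)
    (hv : topVars t = topVars u) : Derives E t u :=
  (derives_of_add_of_subset hE (fun α r => (hs α r).2) hv.ge).trans
    ((derives_comm hE _ _).trans (derives_add_of_subset hE (fun α r => (hs α r).1) hv.le))

/-! ### Derived laws for the hidden action -/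

theorem derives_tau (p : Term A V) : Derives E p p.tau :=
  (derives_tau_add hE p .nil).trans (derives_add_nil hE _)

theorem derives_pre_tau (α : Act A) (p : Term A V) : Derives E (.pre α p.tau) (.pre α p) :=
  calc Derives E (.pre α p.tau) (.pre α (p.tau ∔ p.tau)) := (derives_dup hE _).pre α
    Derives E _ (.pre α p ∔ .pre α p) := derives_merge hE _ _ _
    Derives E _ (.pre α p) := derives_idem hE _

theorem derives_tau_le_add (p q : Term A V) : Derives E p.tau (p.tau ∔ q) :=
  (derives_tau_add hE p.tau q).trans ((derives_pre_tau hE _ p).add (.refl q))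

theorem derives_of_tau_step {u r : Term A V} (h : Step u .tau r) : Derives E r u :=
  (derives_tau_add hE r u).trans (derives_add_of_step hE h).1

theorem derives_tau_of_run {u r u' : Term A V} (h : Step u .tau r) (h' : Run [] r u') :
    Derives E u'.tau u := by
  generalize hw : ([] : List A) = w at h'
  induction h' generalizing u with
  | refl t => exact (derives_tau_le_add hE t u).trans (derives_add_of_step hE h).1
  | tau h₁ _ ih => exact (ih h₁ hw).trans (derives_of_tau_step hE h)
  | obs => cases hw

theorem derives_add_of_not_stable {u : Term A V} (h : ¬ Stable u) (q : Term A V) :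
    Derives E u (u ∔ q) := by
  simp only [Stable, not_forall, not_not] at h
  obtain ⟨r, hr⟩ := h
  calc Derives E u (r.tau ∔ u) := (derives_add_of_step hE hr).2
    Derives E _ (r.tau ∔ q ∔ u) := (derives_tau_le_add hE r q).add (.refl u)
    Derives E _ (r.tau ∔ (q ∔ u)) := derives_assoc hE _ _ _
    Derives E _ (q ∔ u) := derives_add_of_subset hE (by simp; tauto) (by simp)
    Derives E _ (u ∔ q) := derives_comm hE _ _

theorem derives_tau_self {u : Term A V} (h : ¬ Stable u) : Derives E u.tau u := by
  simp only [Stable, not_forall, not_not] at h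
  obtain ⟨r, hr⟩ := h
  calc Derives E u.tau (r.tau ∔ u).tau := (derives_add_of_step hE hr).2.pre _
    Derives E _ (r.tau.tau ∔ u) := derives_tau_dist hE _ _
    Derives E _ (r.tau ∔ u) := (derives_pre_tau hE _ r).add (.refl u)
    Derives E _ u := (derives_add_of_step hE hr).1

/-- Since `τr ≼ τr + r`, a copy of `r` can be exposed next to `u`; it absorbs `p`, and then `r ≼ τr`
folds it back into `u`. -/
theorem derives_absorb_of_tau_step {p u r : Term A V} (h : Step u .tau r)
    (hp : Derives E (p ∔ r) r) : Derives E (p ∔ u) u :=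
  calc Derives E (p ∔ u) (p ∔ (r.tau ∔ u)) := (Derives.refl p).add (derives_add_of_step hE h).2
    Derives E _ (p ∔ (r.tau ∔ r ∔ u)) :=
      (Derives.refl p).add ((derives_tau_le_add hE r r).add (.refl u))
    Derives E _ (p ∔ r ∔ (r.tau ∔ u)) := derives_of_summands hE (by simp; tauto) (by
      simp [Set.union_assoc])
    Derives E _ (r.tau ∔ (r.tau ∔ u)) := (hp.trans (derives_tau hE r)).add (.refl _)
    Derives E _ (r.tau ∔ u) := (Derives.refl _).add (derives_add_of_step hE h).1
    Derives E _ u := (derives_add_of_step hE h).1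

theorem derives_absorb_of_run {p u r : Term A V} (h : Run [] u r)
    (hp : Derives E (p ∔ r) r) : Derives E (p ∔ u) u := by
  generalize hw : ([] : List A) = w at h
  induction h with
  | refl => exact hp
  | tau h _ ih => exact derives_absorb_of_tau_step hE h (ih hp hw)
  | obs => cases hw

theorem derives_pre_sum_tau (α : Act A) {l : List (Term A V)} (hl : l ≠ []) :
    Derives E (.pre α (.sum (l.map Term.tau))) (.sum (l.map (.pre α))) := by
  induction l with
  | nil => exact absurd rfl hl
  | cons p l ih =>
    cases l with
    | nil => exact derives_pre_tau hE α p
    | cons q l =>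
      exact ((((Derives.refl _).add (derives_tau hE _)).pre α).trans
        (derives_merge hE α _ _)).trans ((Derives.refl _).add (ih (by simp)))

end Laws

/-! ### Completeness -/

/-- `u ⇒ -a→ s`. -/
def WeakStep (u : Term A V) (a : A) (s : Term A V) : Prop :=
  ∃ r, Run [] u r ∧ Step r (.obs a) s

theorem weakStep_iff {u s : Term A V} {a : A} :
    WeakStep u a s ↔ Step u (.obs a) s ∨ ∃ r, Step u .tau r ∧ WeakStep r a s := by
  constructor
  · rintro ⟨r, h, h'⟩
    cases h with
    | refl => exact .inl h'
    | tau h₁ h₂ => exact .inr ⟨_, h₁, _, h₂, h'⟩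
  · rintro (h | ⟨r, h, r', h₁, h₂⟩)
    exacts [⟨u, .refl u, h⟩, ⟨r', .tau h h₁, h₂⟩]

theorem Run.exists_weakStep {u u' : Term A V} {a : A} {w : List A} (h : Run (a :: w) u u') :
    ∃ s, WeakStep u a s ∧ Run w s u' := by
  generalize hw : a :: w = w' at h
  induction h with
  | refl => cases hw
  | tau h _ ih =>
    obtain ⟨s, h₁, h₂⟩ := ih hw
    exact ⟨s, weakStep_iff.2 (.inr ⟨_, h, h₁⟩), h₂⟩
  | obs h h' _ => cases hw; exact ⟨_, weakStep_iff.2 (.inl h), h'⟩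

open Classical in
/-- The states `s` with `u ⇒ -a→ s`. -/
noncomputable def weakDerivs (a : A) : Term A V → List (Term A V)
  | .nil => []
  | .var _ => []
  | .pre .tau t => weakDerivs a t
  | .pre (.obs b) t => if b = a then [t] else []
  | .add t u => weakDerivs a t ++ weakDerivs a u

theorem mem_weakDerivs {a : A} {u s : Term A V} : s ∈ weakDerivs a u ↔ WeakStep u a s := by
  induction u with
  | nil => rw [weakStep_iff]; simp [weakDerivs]
  | var => rw [weakStep_iff]; simp [weakDerivs]
  | pre α t ih =>
    rw [weakStep_iff]
    cases α with
    | tau => simp [weakDerivs, ih]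
    | obs b =>
      by_cases h : b = a
      · simp [weakDerivs, h]
      · simp [weakDerivs, h, Ne.symm h]
  | add t u iht ihu =>
    rw [weakStep_iff, weakDerivs, List.mem_append, iht, ihu, weakStep_iff, weakStep_iff (u := u)]
    simp only [step_add, or_and_right, exists_or]
    exact or_or_or_comm

theorem step_sum_map_pre {l : List (Term A V)} {α β : Act A} {r : Term A V} :
    Step (.sum (l.map (.pre α))) β r ↔ β = α ∧ r ∈ l := by
  rw [step_sum]
  simp only [List.mem_map, exists_exists_and_eq_and, step_pre]
  constructor
  · rintro ⟨t, ht, rfl, rfl⟩; exact ⟨rfl, ht⟩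
  · rintro ⟨rfl, h⟩; exact ⟨r, h, rfl, rfl⟩

theorem topVars_sum_map_pre {l : List (Term A V)} {α : Act A} :
    topVars (.sum (l.map (.pre α))) = ∅ := by
  ext x; rw [topVars_sum]; simp

/-- The summands `a s` of `t` are replaced by all the `a s'` with `u ⇒ -a→ s'`. -/
noncomputable def lift (u : Term A V) : Term A V → Term A V
  | .nil => .nil
  | .var x => .var x
  | .pre .tau _ => .nil
  | .pre (.obs a) _ => .sum ((weakDerivs a u).map (.pre (.obs a)))
  | .add t t' => .add (lift u t) (lift u t')

@[simp] theorem topVars_lift (u t : Term A V) : topVars (lift u t) = topVars t := by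
  induction t with
  | nil => rfl
  | var => rfl
  | pre α t =>
    cases α with
    | tau => rfl
    | obs a => exact topVars_sum_map_pre
  | add t t' ih ih' => simp [lift, ih, ih']

theorem step_lift {u t r : Term A V} {α : Act A} :
    Step (lift u t) α r ↔ ∃ a s, α = .obs a ∧ Step t (.obs a) s ∧ WeakStep u a r := by
  induction t with
  | nil => simp [lift]
  | var => simp [lift]
  | pre β t =>
    cases β with
    | tau => simp [lift]
    | obs a =>
      rw [lift, step_sum_map_pre, mem_weakDerivs]
      constructor
      · rintro ⟨rfl, h⟩; exact ⟨a, t, rfl, .pre _ _, h⟩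
      · rintro ⟨b, s, rfl, hs, h⟩
        cases hs; exact ⟨rfl, h⟩
  | add t t' ih ih' =>
    simp only [lift, step_add, ih, ih', or_and_right, and_or_left, exists_or]

theorem derives_lift {E : Axiomatization A V} {u t : Term A V} (hs : Stable t)
    (h : ∀ a s, Step t (.obs a) s →
      Derives E (.pre (.obs a) s) (.sum ((weakDerivs a u).map (.pre (.obs a))))) :
    Derives E t (lift u t) := by
  induction t with
  | nil => exact .refl _
  | var => exact .refl _
  | pre α t =>
    cases α with
    | tau => exact absurd (.pre _ _) (hs t)
    | obs a => exact h a t (.pre _ _)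
  | add t t' ih ih' =>
    exact (ih (fun r hr => hs r (.left hr)) fun a s hr => h a s (.left hr)).add
      (ih' (fun r hr => hs r (.right hr)) fun a s hr => h a s (.right hr))

/-- The weak failures preorder on open terms, with variables as summands of the states. The
variables of a state all of whose actions are enabled are disregarded if `K` holds. -/
structure OpenLE (K : Prop) (t u : Term A V) : Prop where
  failures : ∀ w t', Run w t t' → Stable t' → ∃ u', Run w u u' ∧ Stable u' ∧
    (∀ α r, Step u' α r → ∃ s, Step t' α s) ∧
    (topVars u' ⊆ topVars t' ∨ K ∧ ∀ a, ∃ s, Step t' (.obs a) s)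
  vars : ∀ w t' x, Run w t t' → x ∈ topVars t' → ∃ u', Run w u u' ∧ x ∈ topVars u'
  unstable : ¬ Stable t → ¬ Stable u

theorem OpenLE.weakDerivs_ne_nil {K : Prop} {t u s : Term A V} (h : OpenLE K t u) {a : A}
    (hs : Step t (.obs a) s) : weakDerivs a u ≠ [] := by
  obtain ⟨s', h₁, h₂⟩ := exists_run_stable s
  obtain ⟨u', h₃, -⟩ := h.failures [a] s' (.obs hs h₁) h₂
  obtain ⟨r, hr, -⟩ := h₃.exists_weakStep
  exact List.ne_nil_of_mem (mem_weakDerivs.2 hr)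

/-- A run of `u` whose trace begins with `a` passes through a weak `a`-derivative of `u`, and a
`τ`-move of the sum selects that derivative. The sum is nonempty, hence unstable, so the last clause
of `OpenLE` holds whether or not `s` is stable. -/
theorem OpenLE.weakDerivs {K : Prop} {t u s : Term A V} (h : OpenLE K t u) {a : A}
    (hs : Step t (.obs a) s) : OpenLE K s (.sum ((weakDerivs a u).map Term.tau)) := by
  have key : ∀ {w u'}, Run (a :: w) u u' →
      Run w (.sum ((BCCS.weakDerivs a u).map Term.tau)) u' := by
    intro w u' hr
    obtain ⟨r, h₁, h₂⟩ := hr.exists_weakStep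
    exact .tau (step_sum_map_pre.2 ⟨rfl, mem_weakDerivs.2 h₁⟩) h₂
  refine ⟨fun w t' hw ht' => ?_, fun w t' x hw hx => ?_, fun _ hst => ?_⟩
  · obtain ⟨u', hu', H⟩ := h.failures (a :: w) t' (.obs hs hw) ht'
    exact ⟨u', key hu', H⟩
  · obtain ⟨u', hu', H⟩ := h.vars (a :: w) t' x (.obs hs hw) hx
    exact ⟨u', key hu', H⟩
  · obtain ⟨r, hr⟩ := List.exists_mem_of_ne_nil _ (h.weakDerivs_ne_nil hs)
    exact hst r (step_sum_map_pre.2 ⟨rfl, hr⟩)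

theorem OpenLE.tau_step {K : Prop} {t u r : Term A V} (h : OpenLE K t u)
    (hr : Step t .tau r) : OpenLE K r u :=
  ⟨fun w t' hw => h.failures w t' (.tau hr hw), fun w t' x hw => h.vars w t' x (.tau hr hw),
    fun _ => h.unstable fun hs => hs r hr⟩

section Completeness

variable [Infinite V] {E : Axiomatization A V} (hE : axWF A V ⊆ E)

include hE

theorem derives_add_of_weakStep {u s : Term A V} {a : A} (h : WeakStep u a s) :
    Derives E (.pre (.obs a) s ∔ u) u := by
  obtain ⟨r, h₁, h₂⟩ := h
  exact derives_absorb_of_run hE h₁ (derives_add_of_step hE h₂).1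

theorem OpenLE.derives_add_var {K : Prop} {t u : Term A V} (h : OpenLE K t u) {x : V}
    (hx : x ∈ topVars t) : Derives E (.var x ∔ u) u := by
  obtain ⟨u', h₁, h₂⟩ := h.vars [] t x (.refl t) hx
  exact derives_absorb_of_run hE h₁ (derives_add_of_topVar hE h₂).1

theorem derives_sum_weakDerivs_add (a : A) (u : Term A V) :
    Derives E (.sum ((weakDerivs a u).map (.pre (.obs a))) ∔ u) u := by
  refine derives_absorb hE (fun α r hr => ?_) fun x hx => ?_
  · obtain ⟨rfl, hr'⟩ := step_sum_map_pre.1 hr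
    exact derives_add_of_weakStep hE (mem_weakDerivs.1 hr')
  · rw [topVars_sum_map_pre] at hx; exact hx.elim

theorem OpenLE.derives {K : Prop}
    (hK : K → ∀ t z : Term A V, (∀ a, ∃ s, Step t (.obs a) s) → Derives E t (t ∔ z))
    {t u : Term A V} (h : OpenLE K t u) : Derives E t u := by
  induction hn : size t using Nat.strong_induction_on generalizing t u with
  | _ n ih =>
    have hobs : ∀ a s, Step t (.obs a) s →
        Derives E (.pre (.obs a) s) (.sum ((BCCS.weakDerivs a u).map (.pre (.obs a)))) :=
      fun a s hs => ((ih _ (hn ▸ hs.size_lt) (h.weakDerivs hs) rfl).pre _).trans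
        (derives_pre_sum_tau hE _ (h.weakDerivs_ne_nil hs))
    by_cases ht : Stable t
    -- The stable case: `u'` matches the state `t` itself, at the empty trace.
    · obtain ⟨u', hu, hs, hi, hv⟩ := h.failures [] t (.refl t) ht
      have h₁ : Derives E t (lift u t) := derives_lift ht hobs
      have h₂ : Derives E (lift u t) (u' ∔ lift u t) := by
        obtain hv | ⟨k, hf⟩ := hv
        -- Each action of `u'` is enabled by `t`, and a derivative of `u'` is a weak derivative of
        -- `u`; hence all summands of `u'` already occur in `lift u t`.
        · refine derives_of_add_of_subset hE (fun α r hr => ?_) (by simpa using hv)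
          obtain ⟨s, hs'⟩ := hi α r hr
          cases α with
          | tau => exact absurd hs' (ht s)
          | obs a => exact step_lift.2 ⟨a, s, rfl, hs', u', hu, hr⟩
        -- Here `lift u t` enables every action, because `t` does and `u` has a matching weak
        -- derivative for each.
        · refine (hK k _ u' fun a => ?_).trans (derives_comm hE _ _)
          obtain ⟨s, hs'⟩ := hf a
          obtain ⟨r, hr⟩ := List.exists_mem_of_ne_nil _ (h.weakDerivs_ne_nil hs')
          exact ⟨r, step_lift.2 ⟨a, s, rfl, hs', mem_weakDerivs.1 hr⟩⟩
      have h₃ : Derives E (lift u t ∔ u) u := by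
        refine derives_absorb hE (fun α r hr => ?_) fun x hx => ?_
        · obtain ⟨a, s, rfl, -, hr⟩ := step_lift.1 hr
          exact derives_add_of_weakStep hE hr
        · exact h.derives_add_var hE (by simpa using hx)
      -- If `u'` is `u`, absorption finishes directly. Otherwise a `τ` is put in front and pushed
      -- onto `u'` alone, where `τu' ≼ u` applies.
      cases hu with
      | refl => exact h₁.trans (h₂.trans ((derives_comm hE _ _).trans h₃))
      | tau hr hu =>
        calc Derives E t (lift u t) := h₁
          Derives E _ (lift u t).tau := derives_tau hE _
          Derives E _ (u' ∔ lift u t).tau := h₂.pre _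
          Derives E _ (u'.tau ∔ lift u t) := derives_tau_dist hE _ _
          Derives E _ (u ∔ lift u t) := (derives_tau_of_run hE hr hu).add (.refl _)
          Derives E _ (lift u t ∔ u) := derives_comm hE _ _
          Derives E _ u := h₃
    · have hu := h.unstable ht
      -- An unstable `t` admits any further summand, in particular `u`; it remains to absorb the
      -- summands of `t` into `u`.
      refine (derives_add_of_not_stable hE ht u).trans
        (derives_absorb hE (fun α r hr => ?_) fun x hx => h.derives_add_var hE hx)
      cases α with
      | tau =>
        have := ih _ (hn ▸ hr.size_lt) (h.tau_step hr) rfl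
        exact (((this.pre _).trans (derives_tau_self hE hu)).add (.refl u)).trans
          (derives_idem hE u)
      | obs a =>
        exact ((hobs a r hr).add (.refl u)).trans (derives_sum_weakDerivs_add hE a u)

end Completeness

/-! ### Ground-completeness -/

theorem step_of_initials_subset {u' t' : Term A V} {B : Set A}
    (hB : ∀ a ∉ B, ∃ s, Step t' (.obs a) s) (h : initials u' ⊆ Act.obs '' Bᶜ) :
    ∀ α r, Step u' α r → ∃ s, Step t' α s := by
  intro α r hr
  obtain ⟨a, ha, rfl⟩ := h ⟨r, hr⟩
  exact hB a ha

theorem initials_subset_of_stable {t : Term A V} (ht : Stable t) :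
    initials t ⊆ Act.obs '' {a | ¬ ∃ s, Step t (.obs a) s}ᶜ := by
  rintro (_ | a) ⟨s, hs⟩
  · exact absurd hs (ht s)
  · exact ⟨a, by simpa using ⟨s, hs⟩, rfl⟩

theorem Closed.step {t r : Term A V} {α : Act A} (h : Step t α r) (ht : t.Closed) :
    r.Closed := by
  induction h with
  | pre => exact ht
  | left _ ih => exact ih (Set.union_empty_iff.1 ht).1
  | right _ ih => exact ih (Set.union_empty_iff.1 ht).2

theorem Closed.run {t r : Term A V} {w : List A} (h : Run w t r) (ht : t.Closed) :
    r.Closed := by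
  induction h with
  | refl => exact ht
  | tau h _ ih => exact ih (Closed.step h ht)
  | obs h _ ih => exact ih (Closed.step h ht)

theorem topVars_subset_vars (t : Term A V) : topVars t ⊆ t.vars := by
  induction t with
  | nil => exact subset_rfl
  | var => exact subset_rfl
  | pre => exact Set.empty_subset _
  | add t u iht ihu => exact Set.union_subset_union iht ihu

theorem Closed.topVars_eq {t : Term A V} (ht : t.Closed) : topVars t = ∅ :=
  Set.subset_eq_empty (topVars_subset_vars t) ht

/-- A stable state is tested with the largest set it refuses, so the matching state enables no new
action. Reachable states of closed terms have no variables, so the clauses on variables are trivial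
and `K` can be `False`. -/
theorem axWF_groundComplete [Infinite V] : GroundComplete (axWF A V) WeakFailuresLE := by
  intro p q hp hq h
  refine OpenLE.derives (K := False) subset_rfl False.elim ⟨fun w t' hw ht' => ?_,
    fun w t' x hw hx => ?_, fun hu hs => ?_⟩
  · obtain ⟨u', hu, hi⟩ := fp_iff_run.1
      (h.1 w _ (fp_iff_run.2 ⟨t', hw, initials_subset_of_stable ht'⟩))
    exact ⟨u', hu, .of_initials hi, step_of_initials_subset (by simp) hi,
      .inl (by simp [Closed.topVars_eq (Closed.run hu hq)])⟩
  · rw [Closed.topVars_eq (Closed.run hw hp)] at hx; exact hx.elim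
  · simp only [Stable, not_forall, not_not] at hu
    obtain ⟨r, hr⟩ := h.2 hu
    exact hs r hr

/-! ### `ω`-completeness -/

/-- `aⁿ0` -/
def pow (a : A) : ℕ → Term A V
  | 0 => .nil
  | n + 1 => .pre (.obs a) (pow a n)

theorem run_pow (a : A) (n : ℕ) : Run (List.replicate n a) (pow a n : Term A V) .nil := by
  induction n with
  | zero => exact .refl _
  | succ n ih => exact .obs (.pre _ _) ih

theorem run_pow_inv {a : A} {n : ℕ} {w : List A} {r : Term A V} (h : Run w (pow a n) r) :
    ∃ m, w = List.replicate m a ∧ m ≤ n ∧ r = pow a (n - m) := by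
  generalize ht : (pow a n : Term A V) = t at h
  induction h generalizing n with
  | refl => exact ⟨0, rfl, n.zero_le, by simp [ht]⟩
  | tau h => subst ht; cases n <;> simp [pow] at h
  | obs h _ ih =>
    subst ht
    cases n with
    | zero => simp [pow] at h
    | succ n =>
      simp only [pow, step_pre, Act.obs.injEq] at h
      obtain ⟨rfl, rfl⟩ := h
      obtain ⟨m, rfl, hm, rfl⟩ := ih rfl
      exact ⟨m + 1, rfl, by omega, by simp⟩

theorem closed_pow (a : A) (n : ℕ) : (pow a n : Term A V).Closed := by
  induction n with
  | zero => rfl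
  | succ n ih => exact ih

open Classical in
/-- The substitution that maps the variables in `S` to `aⁿ0` and the other variables to `0`. -/
noncomputable def powSubst (S : Set V) (a : A) (n : ℕ) (x : V) : Term A V :=
  if x ∈ S then pow a n else .nil

theorem closedSubst_powSubst (S : Set V) (a : A) (n : ℕ) : ClosedSubst (powSubst S a n) := by
  intro x
  by_cases h : x ∈ S
  · simpa [powSubst, h] using closed_pow a n
  · simp [powSubst, h, Term.Closed, Term.vars]

/-! ### Transitions and runs of substituted terms -/

theorem Step.subst {t r : Term A V} {α : Act A} (h : Step t α r) (σ : V → Term A V) :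
    Step (t.subst σ) α (r.subst σ) := by
  induction h with
  | pre => exact .pre _ _
  | left _ ih => exact .left ih
  | right _ ih => exact .right ih

theorem Run.subst {t r : Term A V} {w : List A} (h : Run w t r) (σ : V → Term A V) :
    Run w (t.subst σ) (r.subst σ) := by
  induction h with
  | refl => exact .refl _
  | tau h _ ih => exact .tau (h.subst σ) ih
  | obs h _ ih => exact .obs (h.subst σ) ih

theorem step_subst {t r : Term A V} {α : Act A} {σ : V → Term A V} :
    Step (t.subst σ) α r ↔
      (∃ t', Step t α t' ∧ r = t'.subst σ) ∨ ∃ x ∈ topVars t, Step (σ x) α r := by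
  induction t with
  | nil => simp [Term.subst]
  | var x => simp [Term.subst]
  | pre β t => simp [Term.subst, and_assoc]
  | add t u iht ihu =>
    simp only [Term.subst, step_add, iht, ihu, topVars_add, Set.mem_union, or_and_right,
      exists_or]
    exact or_or_or_comm

/-- A run of `t.subst σ` either follows a run of `t` throughout or leaves it at a variable summand
`x` of some state and continues inside `σ x`. The final clause records that `σ x` really moves,
which rules out variables sent to `0`. -/
theorem run_subst {t r : Term A V} {w : List A} {σ : V → Term A V}
    (h : Run w (t.subst σ) r) :
    (∃ t', Run w t t' ∧ r = t'.subst σ) ∨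
      ∃ w₁ w₂ t' x, w = w₁ ++ w₂ ∧ Run w₁ t t' ∧ x ∈ topVars t' ∧ Run w₂ (σ x) r ∧
        ∃ α s, Step (σ x) α s := by
  generalize hs : t.subst σ = s at h
  induction h generalizing t with
  | refl => exact .inl ⟨t, .refl t, hs.symm⟩
  | tau h h' ih =>
    subst hs
    obtain ⟨t₁, h₁, rfl⟩ | ⟨x, hx, h₁⟩ := step_subst.1 h
    · obtain ⟨t', h₂, rfl⟩ | ⟨w₁, w₂, t', x, rfl, h₂, h₃⟩ := ih rfl
      · exact .inl ⟨t', .tau h₁ h₂, rfl⟩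
      · exact .inr ⟨w₁, w₂, t', x, rfl, .tau h₁ h₂, h₃⟩
    · exact .inr ⟨[], _, t, x, rfl, .refl t, hx, .tau h₁ h', _, _, h₁⟩
  | obs h h' ih =>
    subst hs
    obtain ⟨t₁, h₁, rfl⟩ | ⟨x, hx, h₁⟩ := step_subst.1 h
    · obtain ⟨t', h₂, rfl⟩ | ⟨w₁, w₂, t', x, rfl, h₂, h₃⟩ := ih rfl
      · exact .inl ⟨t', .obs h₁ h₂, rfl⟩
      · exact .inr ⟨_ :: w₁, w₂, t', x, rfl, .obs h₁ h₂, h₃⟩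
    · exact .inr ⟨[], _, t, x, rfl, .refl t, hx, .obs h₁ h', _, _, h₁⟩

theorem step_subst_powSubst {t r : Term A V} {α : Act A} {S : Set V} {a : A} {n : ℕ}
    (h : Step (t.subst (powSubst S a n)) α r) :
    (∃ t', Step t α t') ∨ (α = .obs a ∧ ∃ x ∈ topVars t, x ∈ S) := by
  obtain ⟨t', h, -⟩ | ⟨x, hx, h⟩ := step_subst.1 h
  · exact .inl ⟨t', h⟩
  · by_cases hS : x ∈ S
    · cases n with
      | zero => simp [powSubst, pow] at h
      | succ n =>
        simp only [powSubst, hS, if_true, pow, step_pre] at h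
        exact .inr ⟨h.1, x, hx, hS⟩
    · simp [powSubst, hS] at h

theorem run_subst_powSubst {t r : Term A V} {w : List A} {S : Set V} {a : A} {n : ℕ}
    (h : Run w (t.subst (powSubst S a n)) r) :
    (∃ t', Run w t t' ∧ r = t'.subst (powSubst S a n)) ∨
      ∃ w₁ m t' x, w = w₁ ++ List.replicate m a ∧ m ≤ n ∧ Run w₁ t t' ∧ x ∈ topVars t' ∧
        x ∈ S ∧ r = pow a (n - m) := by
  obtain h | ⟨w₁, w₂, t', x, rfl, h₁, hx, h₂, α, s, h₃⟩ := run_subst h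
  · exact .inl h
  · by_cases hS : x ∈ S
    · simp only [powSubst, hS, if_true] at h₂
      obtain ⟨m, rfl, hm, rfl⟩ := run_pow_inv h₂
      exact .inr ⟨w₁, m, t', x, rfl, hm, h₁, hx, hS, rfl⟩
    · simp [powSubst, hS] at h₃

/-- Each clause is read off from one closed substitution, with an exponent large enough to tell a
run inside `u` from one that has entered `aⁿ0`. -/
theorem openLE_of_subst [Nonempty A] {t u : Term A V}
    (h : ∀ ρ, ClosedSubst ρ → WeakFailuresLE (t.subst ρ) (u.subst ρ)) : OpenLE True t u := by
  refine ⟨fun w t' hw ht' => ?_, fun w t' x hw hx => ?_, fun ht hu => ?_⟩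
  · by_cases hf : ∀ a, ∃ s, Step t' (.obs a) s
    · obtain ⟨a⟩ := ‹Nonempty A›
      -- With all variables sent to `0` and nothing to refuse, the pair only asks for a stable state
      -- after `w`; the rest is automatic as `t'` enables every action.
      obtain ⟨r, hr, hi⟩ := fp_iff_run.1 ((h _ (closedSubst_powSubst ∅ a 0)).1 w ∅
        (fp_iff_run.2 ⟨_, hw.subst _, by
          rintro (_ | b) ⟨s, hs⟩
          · obtain ⟨s, hs⟩ | ⟨h, -⟩ := step_subst_powSubst hs
            · exact absurd hs (ht' s)
            · cases h
          · exact ⟨b, by simp, rfl⟩⟩))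
      obtain ⟨u', hu, rfl⟩ | ⟨_, _, _, _, _, _, _, _, h, _⟩ := run_subst_powSubst hr
      · have hu' : Stable u' := fun s hs => Stable.of_initials hi _ (hs.subst _)
        refine ⟨u', hu, hu', ?_, .inr ⟨trivial, hf⟩⟩
        rintro (_ | b) s hs
        exacts [absurd hs (hu' s), hf b]
      · exact h.elim
    · obtain ⟨b, hb⟩ := not_forall.1 hf
      -- The variables of `t'` become `0`, so `t'` still refuses `b`; all others become `b` to the
      -- power `w.length + 1`. Such a variable in `u'` would enable `b`. A run that has entered such
      -- a power cannot use it up along `w`, so it would end in a state enabling `b` too.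
      obtain ⟨r, hr, hi⟩ := fp_iff_run.1
        ((h _ (closedSubst_powSubst (topVars t')ᶜ b (w.length + 1))).1 w _
          (fp_iff_run.2 ⟨_, hw.subst _, by
            refine Set.Subset.trans ?_ (initials_subset_of_stable ht')
            rintro α ⟨s, hs⟩
            obtain h | ⟨-, x, hx, hx'⟩ := step_subst_powSubst hs
            exacts [h, absurd hx hx']⟩))
      have hnb : ¬ ∃ s, Step r (.obs b) s := fun hs => by
        obtain ⟨a, ha, hab⟩ := hi hs
        cases hab
        exact ha hb
      obtain ⟨u', hu, rfl⟩ | ⟨w₁, m, _, _, rfl, _, _, _, _, rfl⟩ := run_subst_powSubst hr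
      · refine ⟨u', hu, fun s hs => Stable.of_initials hi _ (hs.subst _),
          fun α s hs => step_of_initials_subset (by simp) hi α _ (hs.subst _), .inl ?_⟩
        intro x hx
        by_contra hx'
        exact hnb ⟨pow b w.length, step_subst.2 (.inr ⟨x, hx, by simp [powSubst, hx', pow]⟩)⟩
      · refine (hnb ?_).elim
        rw [List.length_append, List.length_replicate,
          show w₁.length + m + 1 - m = w₁.length + 1 by omega]
        exact ⟨_, .pre _ _⟩
  · obtain ⟨a⟩ := ‹Nonempty A›
    -- The power of `a` is longer than any run of `u`, so the matching run must enter a copy of `x`.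
    -- Refusing every action forces it to exhaust that copy, so exactly `w` was performed before.
    obtain ⟨r, hr, hi⟩ := fp_iff_run.1
      ((h _ (closedSubst_powSubst {x} a (size u + 1))).1 (w ++ List.replicate (size u + 1) a)
        Set.univ (fp_iff_run.2 ⟨.nil, (hw.subst _).trans (.obs (step_subst.2 (.inr ⟨x, hx, by
          simp [powSubst, pow]⟩)) (run_pow a (size u))), by
          rintro α ⟨s, hs⟩; simp at hs⟩))
    obtain ⟨u', hu, -⟩ | ⟨w₁, m, u', y, hm, hm', hu, hy, rfl, rfl⟩ := run_subst_powSubst hr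
    · have := hu.length_le
      simp at this
      omega
    · obtain ⟨k, hk⟩ := Nat.exists_eq_add_of_le hm'
      cases k with
      | zero =>
        obtain rfl : size u + 1 = m := hk
        exact ⟨u', List.append_cancel_right hm ▸ hu, hy⟩
      | succ k =>
        rw [show size u + 1 - m = k + 1 by omega] at hi
        obtain ⟨b, hb, -⟩ := hi ⟨_, .pre _ _⟩
        exact absurd (Set.mem_univ b) hb
  · obtain ⟨a⟩ := ‹Nonempty A›
    simp only [Stable, not_forall, not_not] at ht
    obtain ⟨r, hr⟩ := ht
    obtain ⟨s, hs⟩ := (h _ (closedSubst_powSubst ∅ a 0)).2 ⟨_, hr.subst _⟩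
    obtain ⟨u', hu'⟩ | ⟨h, -⟩ := step_subst_powSubst hs
    · exact hu u' hu'
    · cases h

/-- One summand `a (s a)` of `t` is chosen for each `a`. Their sum `S` is an instance of the left
side of the extra axiom, and `t` absorbs it. -/
theorem derives_full [Infinite V] [Finite A] {E : Axiomatization A V}
    (hE : axWF A V ∪ axF2 A V ⊆ E) (t z : Term A V) (ht : ∀ a, ∃ s, Step t (.obs a) s) :
    Derives E t (t ∔ z) := by
  have hE' := Set.subset_union_left.trans hE
  have := Fintype.ofFinite A
  choose s hs using ht
  -- An embedding of `Option A` provides the distinct variables: `some a` for the one under the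
  -- prefix `a`, `none` for the added summand.
  obtain ⟨g, hg⟩ := Countable.exists_injective_nat (Option A)
  obtain ⟨f⟩ : Nonempty (Option A ↪ V) :=
    ⟨(⟨g, hg⟩ : Option A ↪ ℕ).trans (Infinite.natEmbedding V)⟩
  let l : List A := Finset.univ.toList
  let σ := Function.extend f (fun o => o.elim z s) fun _ => .nil
  have hσ : ∀ o, σ (f o) = o.elim z s := f.injective.extend_apply _ _
  have key := Derives.inst (E := E) (hE (.inr ⟨l, fun a => f (some a), f none,
    Finset.nodup_toList _, fun a => Finset.mem_toList.2 (Finset.mem_univ a),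
    fun a b h => Option.some.inj (f.injective h), fun a h => Option.some_ne_none a (f.injective h), rfl⟩)) σ
  have hmap : (l.map fun a => Term.pre (.obs a) (.var (f (some a)))).map (Term.subst σ) =
      l.map fun a => .pre (.obs a) (s a) := by simp [Term.subst, hσ]
  rw [Term.subst, subst_sum, hmap, Term.subst, hσ] at key
  set S : Term A V := .sum (l.map fun a => .pre (.obs a) (s a))
  have hsub : ∀ α r, Step S α r → Step t α r := by
    intro α r hr
    obtain ⟨p, hp, hr⟩ := step_sum.1 hr
    obtain ⟨a, -, rfl⟩ := List.mem_map.1 hp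
    obtain ⟨rfl, rfl⟩ := step_pre.1 hr
    exact hs a
  have hvars : topVars S ⊆ topVars t := by
    intro x hx
    obtain ⟨p, hp, hx⟩ := topVars_sum.1 hx
    obtain ⟨a, -, rfl⟩ := List.mem_map.1 hp
    exact hx.elim
  calc Derives E t (S ∔ t) := derives_of_add_of_subset hE' hsub hvars
    Derives E _ (S ∔ z ∔ t) := key.add (.refl t)
    Derives E _ (S ∔ (z ∔ t)) := derives_assoc hE' _ _ _
    Derives E _ (z ∔ t) := derives_add_of_subset hE' (fun α r h => .right (hsub α r h))
      (hvars.trans Set.subset_union_right)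
    Derives E _ (t ∔ z) := derives_comm hE' _ _

theorem finite_initials (t : Term A V) : (initials t).Finite := by
  induction t with
  | nil => simp [initials]
  | var => simp [initials]
  | pre => simp [initials]
  | add t u iht ihu => rw [initials_add]; exact iht.union ihu

theorem Closed.subst_eq {t : Term A V} (ht : t.Closed) (σ : V → Term A V) : t.subst σ = t := by
  induction t with
  | nil => rfl
  | var => exact absurd ht (Set.singleton_ne_empty _)
  | pre α t ih => rw [Term.subst, ih ht]
  | add t u iht ihu =>
    obtain ⟨h₁, h₂⟩ := Set.union_empty_iff.1 ht
    rw [Term.subst, iht h₁, ihu h₂]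

/-- Soundness turns derivability of all closed instances into weak failures inclusion, since a
further closed substitution leaves closed terms unchanged; `openLE_of_subst` and `OpenLE.derives`
then apply with `K := True`. -/
theorem omegaComplete_of_sound [Nonempty A] [Infinite V] {E : Axiomatization A V}
    (hE : axWF A V ⊆ E) (hs : Sound E WeakFailuresLE)
    (hK : ∀ t z : Term A V, (∀ a, ∃ s, Step t (.obs a) s) → Derives E t (t ∔ z)) :
    OmegaComplete E := fun t u h =>
  (openLE_of_subst fun ρ hρ => by
    simpa only [subst_subst, Closed.subst_eq (hρ _)] using hs _ _ (h ρ hρ) ρ hρ).derives hE fun _ => hK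

end BCCS

theorem mainTheorem11 {A : Type*} {V : Type*} [Nonempty A] [Countable A]
    [Countable V] [Infinite V] :
    BCCS.Sound (BCCS.axWF A V) BCCS.WeakFailuresLE ∧
    BCCS.GroundComplete (BCCS.axWF A V) BCCS.WeakFailuresLE ∧
    (Infinite A → BCCS.OmegaComplete (BCCS.axWF A V)) ∧
    (Finite A → BCCS.Sound (BCCS.axWF A V ∪ BCCS.axF2 A V) BCCS.WeakFailuresLE ∧
      BCCS.OmegaComplete (BCCS.axWF A V ∪ BCCS.axF2 A V)) := by
  refine ⟨BCCS.axWF_sound, BCCS.axWF_groundComplete, fun _ => ?_, fun _ =>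
    ⟨BCCS.axWF_axF2_sound, ?_⟩⟩
  · refine BCCS.omegaComplete_of_sound subset_rfl BCCS.axWF_sound fun t z ht => ?_
    -- For infinite `A` the assumption `ht` is contradictory: a term has only finitely many initial
    -- actions.
    refine absurd ?_ (Set.infinite_range_of_injective (f := BCCS.Act.obs (A := A))
      fun a b h => BCCS.Act.obs.inj h)
    exact (BCCS.finite_initials t).subset (Set.range_subset_iff.2 ht)
  · exact BCCS.omegaComplete_of_sound Set.subset_union_left BCCS.axWF_axF2_sound
      (BCCS.derives_full subset_rfl)
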